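/- Let $N\ge 2$, $p\in[2,\infty)$, $q=\frac{N+2}{N+p}$, and let $\Omega\subset\mathbb{R}^N$ be a bounded Lipschitz domain, that is, a nonempty bounded connected open set which in a ball around each boundary point is, in the direction of some unit vector, the region strictly above the graph of a Lipschitz function. For $\varepsilon>0$ put $\Omega_\varepsilon=\{x\in\mathbb{R}^N: d(x,\Omega)\le\varepsilon\}$ and $\Gamma_\varepsilon=\Omega_\varepsilon\setminus\overline\Omega$. Let $F\colon\partial\Omega\to\mathbb{R}$ be Lipschitz continuous with constant $K$. A control is a Borel map $\sigma\colon\overline\Omega\to\mathbb{S}^{N-1}$. For a control $\sigma$ and a starting point $x_0\in\Omega_\varepsilon$, let $(x_n)_{n\ge0}$ be the Markov chain with law $\mathbb{P}^{x_0}_\sigma$, started at $x_0$, with transition probabilities $$\gamma[x]=q\,\frac{|B_\varepsilon(x)\cap\,\cdot\,|}{|B_\varepsilon(x)|}+\frac{1-q}{2}\bigl(\delta_{x+\varepsilon\sigma(x)}+\delta_{x-\varepsilon\sigma(x)}\bigr)\ \text{ for } x\in\overline\Omega,\qquad \gamma[x]=\delta_x\ \text{ for } x\in\Gamma_\varepsilon,$$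 and let $\tau_\sigma=\min\{n\ge 0: x_n\in\Gamma_\varepsilon\}$, which is finite almost surely. Extend $F$ to $\partial\Omega\cup\Gamma_\varepsilon$ with the same Lipschitz constant $K$, and let $$u_\varepsilon(x_0)=\sup_\sigma\,\mathbb{E}^{x_0}_\sigma[F(x_{\tau_\sigma})],$$ the supremum being taken over all controls $\sigma$. Then for every $\eta>0$ there are $\varepsilon_0>0$ and $\varepsilon_1>0$ such that, for all $y_0\in\partial\Omega$, all $0<\varepsilon<\varepsilon_0$, every such extension of $F$ and all $x\in B_{\varepsilon_1}(y_0)\cap\overline\Omega$, $$|u_\varepsilon(x)-F(y_0)|\le\eta.$$ -/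

import Mathlib

open MeasureTheory ProbabilityTheory Set Metric
open scoped NNReal ENNReal

noncomputable section

namespace DominativeGame

/-- The Euclidean space `ℝ^N`. -/
abbrev E (N : ℕ) : Type := EuclideanSpace ℝ (Fin N)

variable {N : ℕ}

/-- A bounded Lipschitz domain: a nonempty, bounded, connected open set which, in a ball around
each of its boundary points, is the region strictly above the graph of a Lipschitz function, in
the direction of some unit vector `e`.
The point `x - ⟪e, x⟫ e` is the orthogonal projection of `x` to the hyperplane `e^⊥`, so only the
values of `φ` on that hyperplane matter. -/
structure IsBoundedLipschitzDomain (Ω : Set (E N)) : Prop where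
  isOpen : IsOpen Ω
  isConnected : IsConnected Ω
  isBounded : Bornology.IsBounded Ω
  boundary : ∀ y ∈ frontier Ω, ∃ (r : ℝ) (e : E N) (L : ℝ≥0) (φ : E N → ℝ),
    0 < r ∧ ‖e‖ = 1 ∧ LipschitzWith L φ ∧
      ∀ x ∈ ball y r, x ∈ Ω ↔ φ (x - inner ℝ e x • e) < inner ℝ e x

/-- `Ω_ε = {x : d(x, Ω) ≤ ε}`. -/
def enlarged (Ω : Set (E N)) (ε : ℝ) : Set (E N) := cthickening ε Ω

/-- The outer strip `Γ_ε = Ω_ε \ closure Ω`. -/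
def outerStrip (Ω : Set (E N)) (ε : ℝ) : Set (E N) := enlarged Ω ε \ closure Ω

/-- `q = (N + 2) / (N + p)`, the probability of a uniformly distributed step. -/
def qOf (N : ℕ) (p : ℝ) : ℝ := (N + 2) / (N + p)

/-- A control: a Borel map from the closure of `Ω` to the unit sphere. -/
def Control (Ω : Set (E N)) : Type :=
  {σ : closure Ω → sphere (0 : E N) 1 // Measurable σ}

open Classical in
/-- The transition probability `γ[x]`. For `x ∈ closure Ω` the next point is uniformly distributed
in the ball `B_ε(x)` with probability `q`, and it is `x + ε σ(x)` or `x - ε σ(x)` with probability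
`(1 - q) / 2` each. At the other points, in particular on `Γ_ε`, the process stays where it is. -/
def stepMeasure (p ε : ℝ) {Ω : Set (E N)} (σ : Control Ω) (x : E N) : Measure (E N) :=
  if h : x ∈ closure Ω then
    ENNReal.ofReal (qOf N p) • cond volume (ball x ε) +
      ENNReal.ofReal ((1 - qOf N p) / 2) •
        (Measure.dirac (x + ε • (σ.1 ⟨x, h⟩ : E N)) + Measure.dirac (x - ε • (σ.1 ⟨x, h⟩ : E N)))
  else Measure.dirac x

theorem measurable_cond_ball (ε : ℝ) :
    Measurable fun x : E N => cond (volume : Measure (E N)) (ball x ε) := by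
  refine Measure.measurable_of_measurable_coe _ fun A hA => ?_
  simp only [cond_apply measurableSet_ball, Measure.addHaar_ball_center]
  refine Measurable.const_mul ?_ _
  have hS : MeasurableSet {z : E N × E N | z.2 ∈ ball z.1 ε ∩ A} := by
    exact (measurableSet_lt (measurable_snd.dist measurable_fst) measurable_const).inter
      (measurable_snd hA)
  exact measurable_measure_prodMk_left hS

theorem measurable_stepMeasure (p ε : ℝ) {Ω : Set (E N)} (σ : Control Ω) :
    Measurable (stepMeasure p ε σ) := by
  classical
  have hσ : Measurable fun x : closure Ω => (σ.1 x : E N) := measurable_subtype_coe.comp σ.2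
  have hx : Measurable fun x : closure Ω => (x : E N) := measurable_subtype_coe
  have h1 : Measurable fun x : closure Ω =>
      ENNReal.ofReal (qOf N p) • cond volume (ball (x : E N) ε) +
      ENNReal.ofReal ((1 - qOf N p) / 2) •
        (Measure.dirac ((x : E N) + ε • (σ.1 x : E N)) +
          Measure.dirac ((x : E N) - ε • (σ.1 x : E N))) := by
    have ha : Measurable fun x : closure Ω => (x : E N) + ε • (σ.1 x : E N) :=
      hx.add (hσ.const_smul ε)
    have hb : Measurable fun x : closure Ω => (x : E N) - ε • (σ.1 x : E N) :=
      hx.sub (hσ.const_smul ε)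
    refine Measure.measurable_of_measurable_coe _ fun A hA => ?_
    simp only [Measure.add_apply, Measure.smul_apply, smul_eq_mul]
    have e0 := (Measure.measurable_coe hA).comp ((measurable_cond_ball ε).comp hx)
    have e1 := (Measure.measurable_coe hA).comp (Measure.measurable_dirac.comp ha)
    have e2 := (Measure.measurable_coe hA).comp (Measure.measurable_dirac.comp hb)
    exact (e0.const_mul _).add ((e1.add e2).const_mul _)
  have h2 : Measurable fun x : ((closure Ω)ᶜ : Set (E N)) => Measure.dirac (x : E N) :=
    Measure.measurable_dirac.comp measurable_subtype_coe
  exact Measurable.dite (s := closure Ω) h1 h2 isClosed_closure.measurableSet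

theorem qOf_nonneg (N : ℕ) {p : ℝ} (hp : 2 ≤ p) : 0 ≤ qOf N p := by
  unfold qOf; positivity

theorem qOf_le_one (N : ℕ) {p : ℝ} (hp : 2 ≤ p) : qOf N p ≤ 1 := by
  unfold qOf
  rw [div_le_one (by positivity)]
  linarith

theorem isProbabilityMeasure_stepMeasure {p ε : ℝ} (hp : 2 ≤ p) (hε : 0 < ε) {Ω : Set (E N)}
    (σ : Control Ω) (x : E N) : IsProbabilityMeasure (stepMeasure p ε σ x) := by
  unfold stepMeasure
  split_ifs with h
  · have h0 : (volume : Measure (E N)) (ball x ε) ≠ 0 := (measure_ball_pos volume x hε).ne'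
    have hfin : (volume : Measure (E N)) (ball x ε) ≠ ∞ := measure_ball_lt_top.ne
    have : IsProbabilityMeasure (cond (volume : Measure (E N)) (ball x ε)) :=
      cond_isProbabilityMeasure_of_finite h0 hfin
    have hq := qOf_nonneg N hp
    have hq1 := qOf_le_one N hp
    refine ⟨?_⟩
    simp only [Measure.add_apply, Measure.smul_apply, smul_eq_mul, measure_univ, mul_one]
    rw [← ENNReal.ofReal_one, ← ENNReal.ofReal_add (by norm_num) (by norm_num),
      ← ENNReal.ofReal_mul (by linarith), ← ENNReal.ofReal_add hq (by linarith)]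
    congr 1
    ring
  · infer_instance

/-- The transition probabilities as a Markov kernel on `ℝ^N`. -/
def stepKernel (p ε : ℝ) {Ω : Set (E N)} (σ : Control Ω) : Kernel (E N) (E N) :=
  ⟨stepMeasure p ε σ, measurable_stepMeasure p ε σ⟩

/-- The transition from the history `(x₀, …, x_n)` to `x_{n+1}`, which depends on `x_n` only. -/
def historyKernel (p ε : ℝ) {Ω : Set (E N)} (σ : Control Ω) (n : ℕ) :
    Kernel ((_ : Finset.Iic n) → E N) (E N) :=
  (stepKernel p ε σ).comap (fun h => h ⟨n, Finset.mem_Iic.2 le_rfl⟩) (measurable_pi_apply _)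

theorem isMarkovKernel_historyKernel {p ε : ℝ} (hp : 2 ≤ p) (hε : 0 < ε) {Ω : Set (E N)}
    (σ : Control Ω) (n : ℕ) : IsMarkovKernel (historyKernel p ε σ n) :=
  ⟨fun h => isProbabilityMeasure_stepMeasure hp hε σ (h ⟨n, Finset.mem_Iic.2 le_rfl⟩)⟩

/-- The law `ℙ^{x₀}_σ` of the process `(x₀, x₁, x₂, …)` started at `x₀`, obtained from the
transition probabilities by the Ionescu-Tulcea theorem. -/
def pathLaw {p ε : ℝ} (hp : 2 ≤ p) (hε : 0 < ε) {Ω : Set (E N)} (σ : Control Ω) (x₀ : E N) :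
    Measure (ℕ → E N) :=
  haveI := isMarkovKernel_historyKernel hp hε σ
  Kernel.traj (X := fun _ => E N) (historyKernel p ε σ) 0 (fun _ => x₀)

open Classical in
/-- The exit time `τ(ω) = min {n : x_n ∈ Γ_ε}`, with `min ∅ = ∞`. -/
def exitTime (Ω : Set (E N)) (ε : ℝ) (ω : ℕ → E N) : ℕ∞ :=
  if ∃ n, ω n ∈ outerStrip Ω ε then ((sInf {n | ω n ∈ outerStrip Ω ε} : ℕ) : ℕ∞) else ⊤

open Classical in
/-- The payoff `F(x_τ)`; on the null event `τ = ∞` it is set to `0`. -/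
def payoff (Ω : Set (E N)) (ε : ℝ) (F : E N → ℝ) (ω : ℕ → E N) : ℝ :=
  if exitTime Ω ε ω = ⊤ then 0 else F (ω (exitTime Ω ε ω).toNat)

/-- The `ε`-stochastic solution `u_ε(x₀) = sup_σ 𝔼^{x₀}_σ[F(x_τ)]`. -/
def stochasticSolution {p ε : ℝ} (hp : 2 ≤ p) (hε : 0 < ε) (Ω : Set (E N)) (F : E N → ℝ)
    (x₀ : E N) : ℝ :=
  ⨆ σ : Control Ω, ∫ ω, payoff Ω ε F ω ∂(pathLaw hp hε σ x₀)

end DominativeGame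

end


/-!
Every step of the game is symmetric and has, by its uniformly distributed part, variance at least
`c ε ^ 2` in every direction, with `c` independent of the control. Hence a Gaussian bump centred
outside `closure Ω` increases on average along each step inside `closure Ω` once its exponent is
large compared with the inverse square of the distance to its centre. Two consequences are drawn
from this, both uniform in the control.

With a centre far away, the bump is a Lyapunov function, so the game ends almost surely.

With centres in exterior balls of radius comparable to `r` at distance at most `r` from `y₀`, which
exist since `Ω` is locally above a Lipschitz graph, each bump bounds by some `θ < 1`, independent of
`r`, the probability of travelling from distance `r` to distance `4 r` from `y₀`. Pasting `n` such
barriers at geometrically decreasing scales gives the bound `θ ^ n` for the probability of ending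
far from `y₀`. Outside that event the payoff is close to `F y₀` since `F` is Lipschitz.
-/

noncomputable section

namespace DominativeGame

section MarkovChain

variable {X : Type*} [MeasurableSpace X] {κ : Kernel X X}

/-- A nonnegative function that does not increase on average along the transition kernel `κ`. -/
structure IsExcessive (κ : Kernel X X) (v : X → ℝ≥0∞) : Prop where
  measurable : Measurable v
  lintegral_le : ∀ x, ∫⁻ y, v y ∂κ x ≤ v x

theorem IsExcessive.const_mul {v : X → ℝ≥0∞} (hv : IsExcessive κ v) (c : ℝ≥0∞) :
    IsExcessive κ fun x => c * v x where
  measurable := hv.measurable.const_mul c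
  lintegral_le x := by
    rw [lintegral_const_mul c hv.measurable]
    gcongr
    exact hv.lintegral_le x

theorem IsExcessive.piecewise_inf {v w : X → ℝ≥0∞} (hv : IsExcessive κ v) (hw : IsExcessive κ w)
    {B : Set X} [DecidablePred (· ∈ B)] (hB : MeasurableSet B)
    (h : ∀ x ∈ B, w x < v x → ∀ᵐ y ∂κ x, y ∈ B) : IsExcessive κ (B.piecewise (v ⊓ w) v) where
  measurable := (hv.measurable.inf hw.measurable).piecewise hB hv.measurable
  lintegral_le x := by
    have hle_v : ∫⁻ y, B.piecewise (v ⊓ w) v y ∂κ x ≤ v x :=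
      (lintegral_mono (piecewise_le (fun _ _ => inf_le_left) fun _ _ => le_rfl)).trans
        (hv.lintegral_le x)
    by_cases hx : x ∈ B
    · rw [piecewise_eq_of_mem _ _ _ hx]
      refine le_inf hle_v ?_
      rcases le_or_gt (v x) (w x) with hvw | hwv
      · exact hle_v.trans hvw
      · refine (lintegral_mono_ae ?_).trans (hw.lintegral_le x)
        filter_upwards [h x hx hwv] with y hy
        simp only [piecewise_eq_of_mem _ _ _ hy, Pi.inf_apply, inf_le_right]
    · rwa [piecewise_eq_of_notMem _ _ _ hx]

variable (κ) [IsMarkovKernel κ] (x₀ : X)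

/-- The law of the time-homogeneous Markov chain with transition kernel `κ` started at `x₀`, as a
measure on the space of trajectories. -/
def markovLaw : Measure (ℕ → X) :=
  Kernel.traj (X := fun _ => X)
    (fun n => κ.comap (fun h => h ⟨n, Finset.mem_Iic.2 le_rfl⟩) (measurable_pi_apply _)) 0
    fun _ => x₀

instance : IsProbabilityMeasure (markovLaw κ x₀) := by
  unfold markovLaw; infer_instance

theorem map_markovLaw_zero : (markovLaw κ x₀).map (fun ω => ω 0) = Measure.dirac x₀ := by
  have heval : Measurable fun h : (_ : Finset.Iic 0) → X => h ⟨0, Finset.mem_Iic.2 le_rfl⟩ :=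
    measurable_pi_apply _
  calc (markovLaw κ x₀).map (fun ω => ω 0)
    _ = ((markovLaw κ x₀).map (Preorder.frestrictLe 0)).map
          fun h => h ⟨0, Finset.mem_Iic.2 le_rfl⟩ :=
        (Measure.map_map heval (Preorder.measurable_frestrictLe (X := fun _ => X) 0)).symm
    _ = Measure.dirac x₀ := by
        rw [markovLaw, Kernel.traj_map_frestrictLe_apply, Kernel.partialTraj_self, Kernel.id_apply,
          Measure.map_dirac' heval]

theorem map_markovLaw_prodMk_succ (n : ℕ) :
    (markovLaw κ x₀).map (fun ω => (ω n, ω (n + 1))) =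
      (markovLaw κ x₀).map (fun ω => ω n) ⊗ₘ κ := by
  set ν : (n : ℕ) → Kernel ((_ : Finset.Iic n) → X) X := fun n =>
    κ.comap (fun h => h ⟨n, Finset.mem_Iic.2 le_rfl⟩) (measurable_pi_apply _)
  let last (h : (_ : Finset.Iic n) → X) : X := h ⟨n, Finset.mem_Iic.2 le_rfl⟩
  have hlast : Measurable last := measurable_pi_apply _
  refine Measure.ext_of_lintegral _ fun f hf => ?_
  have hpair : Measurable fun z : ((_ : Finset.Iic n) → X) × X => f (last z.1, z.2) := by fun_prop
  have hhist : Measurable fun ω : ℕ → X => (Preorder.frestrictLe n ω, ω (n + 1)) := by fun_prop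
  calc ∫⁻ z, f z ∂(markovLaw κ x₀).map (fun ω => (ω n, ω (n + 1)))
    _ = ∫⁻ ω, f (ω n, ω (n + 1)) ∂markovLaw κ x₀ := lintegral_map hf (by fun_prop)
    _ = ∫⁻ z, f (last z.1, z.2) ∂(markovLaw κ x₀).map
          fun ω => (Preorder.frestrictLe n ω, ω (n + 1)) :=
        (lintegral_map hpair hhist).symm
    _ = ∫⁻ z, f (last z.1, z.2)
          ∂Kernel.partialTraj (X := fun _ => X) ν 0 n (fun _ => x₀) ⊗ₘ ν n := by
        rw [Kernel.partialTraj_compProd_eq_map_traj n.zero_le]; rfl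
    _ = ∫⁻ h, ∫⁻ y, f (last h, y) ∂κ (last h) ∂(markovLaw κ x₀).map (Preorder.frestrictLe n) := by
        rw [Measure.lintegral_compProd hpair, markovLaw, Kernel.traj_map_frestrictLe_apply]; rfl
    _ = ∫⁻ ω, ∫⁻ y, f (ω n, y) ∂κ (ω n) ∂markovLaw κ x₀ :=
        lintegral_map (hf.lintegral_kernel_prod_right'.comp hlast)
          (Preorder.measurable_frestrictLe n)
    _ = ∫⁻ z, f z ∂(markovLaw κ x₀).map (fun ω => ω n) ⊗ₘ κ := by
        rw [Measure.lintegral_compProd hf,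
          lintegral_map hf.lintegral_kernel_prod_right' (measurable_pi_apply n)]

theorem lintegral_markovLaw_zero {f : X → ℝ≥0∞} (hf : Measurable f) :
    ∫⁻ ω, f (ω 0) ∂markovLaw κ x₀ = f x₀ := by
  rw [← lintegral_map hf (measurable_pi_apply 0), map_markovLaw_zero, lintegral_dirac' x₀ hf]

theorem lintegral_markovLaw_succ (n : ℕ) {f : X → ℝ≥0∞} (hf : Measurable f) :
    ∫⁻ ω, f (ω (n + 1)) ∂markovLaw κ x₀ = ∫⁻ ω, ∫⁻ y, f y ∂κ (ω n) ∂markovLaw κ x₀ := by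
  have hf' : Measurable fun z : X × X => f z.2 := hf.comp measurable_snd
  have hpair : Measurable fun ω : ℕ → X => (ω n, ω (n + 1)) := by fun_prop
  calc ∫⁻ ω, f (ω (n + 1)) ∂markovLaw κ x₀
    _ = ∫⁻ z, f z.2 ∂(markovLaw κ x₀).map (fun ω => (ω n, ω (n + 1))) :=
        (lintegral_map hf' hpair).symm
    _ = ∫⁻ ω, ∫⁻ y, f y ∂κ (ω n) ∂markovLaw κ x₀ := by
        rw [map_markovLaw_prodMk_succ, Measure.lintegral_compProd hf',
          lintegral_map hf'.lintegral_kernel_prod_right' (measurable_pi_apply n)]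

variable {κ}

theorem ae_markovLaw_forall_mem_succ {S : Set X} (hS : MeasurableSet S)
    (h : ∀ x ∈ S, ∀ᵐ y ∂κ x, y ∈ S) :
    ∀ᵐ ω ∂markovLaw κ x₀, ∀ n, ω n ∈ S → ω (n + 1) ∈ S := by
  have hstep : MeasurableSet {z : X × X | z.1 ∈ S → z.2 ∈ S} :=
    (measurable_fst hS).imp (measurable_snd hS)
  refine ae_all_iff.2 fun n => ae_of_ae_map (f := fun ω : ℕ → X => (ω n, ω (n + 1)))
    (p := fun z => z.1 ∈ S → z.2 ∈ S) (by fun_prop) ?_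
  rw [map_markovLaw_prodMk_succ, Measure.ae_compProd_iff hstep]
  exact Filter.Eventually.of_forall fun x => Filter.eventually_imp_distrib_left.2 (h x)

theorem ae_markovLaw_forall_mem {S : Set X} (hS : MeasurableSet S)
    (h : ∀ x ∈ S, ∀ᵐ y ∂κ x, y ∈ S) (hx₀ : x₀ ∈ S) : ∀ᵐ ω ∂markovLaw κ x₀, ∀ n, ω n ∈ S := by
  have hstart : ∀ᵐ ω ∂markovLaw κ x₀, ω 0 ∈ S := by
    refine ae_of_ae_map (f := fun ω : ℕ → X => ω 0) (p := fun x => x ∈ S)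
      (measurable_pi_apply 0).aemeasurable ?_
    rw [map_markovLaw_zero]
    exact (ae_dirac_iff hS).2 hx₀
  filter_upwards [hstart, ae_markovLaw_forall_mem_succ x₀ hS h] with ω h0 hsucc n
  exact Nat.rec h0 hsucc n

theorem lintegral_add_sum_markovLaw_le {V g : X → ℝ≥0∞} (hV : Measurable V) (hg : Measurable g)
    (h : ∀ x, ∫⁻ y, V y ∂κ x + g x ≤ V x) (n : ℕ) :
    ∫⁻ ω, V (ω n) ∂markovLaw κ x₀ + ∑ k ∈ Finset.range n, ∫⁻ ω, g (ω k) ∂markovLaw κ x₀ ≤ V x₀ := by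
  induction n with
  | zero => simp [lintegral_markovLaw_zero κ x₀ hV]
  | succ n ih =>
    have hstep : ∫⁻ ω, V (ω (n + 1)) ∂markovLaw κ x₀ + ∫⁻ ω, g (ω n) ∂markovLaw κ x₀ ≤
        ∫⁻ ω, V (ω n) ∂markovLaw κ x₀ := by
      rw [lintegral_markovLaw_succ κ x₀ n hV, ← lintegral_add_right _ (by fun_prop)]
      exact lintegral_mono fun ω => h (ω n)
    rw [Finset.sum_range_succ, add_left_comm, add_comm]
    exact (add_le_add_left hstep _).trans ih

/-- The Foster–Lyapunov criterion. -/
theorem ae_markovLaw_eventually_notMem {V : X → ℝ≥0∞} (hV : Measurable V) {A : Set X}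
    (hA : MeasurableSet A) {c : ℝ≥0∞} (hc : c ≠ 0)
    (h : ∀ x, ∫⁻ y, V y ∂κ x + A.indicator (fun _ => c) x ≤ V x) (hx₀ : V x₀ ≠ ∞) :
    ∀ᵐ ω ∂markovLaw κ x₀, ∀ᶠ n in Filter.atTop, ω n ∉ A := by
  have hind (k : ℕ) : ∫⁻ ω, A.indicator (fun _ => c) (ω k) ∂markovLaw κ x₀ =
      c * markovLaw κ x₀ {ω | ω k ∈ A} :=
    lintegral_indicator_const (measurable_pi_apply k hA) c
  have hsum : c * ∑' k, markovLaw κ x₀ {ω | ω k ∈ A} ≤ V x₀ := by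
    rw [← ENNReal.tsum_mul_left]
    refine ENNReal.tsum_le_of_sum_range_le fun n => ?_
    simp_rw [← hind]
    exact le_add_self.trans
      (lintegral_add_sum_markovLaw_le x₀ hV (measurable_const.indicator hA) h n)
  exact ae_eventually_notMem fun htop =>
    hx₀ (top_le_iff.1 ((ENNReal.mul_top hc).symm.trans_le (htop ▸ hsum)))

theorem IsExcessive.markovLaw_exists_mem_le {v : X → ℝ≥0∞} (hv : IsExcessive κ v) {S : Set X}
    (hS : MeasurableSet S) (hinv : ∀ x ∈ S, ∀ᵐ y ∂κ x, y ∈ S) (h1 : ∀ x ∈ S, 1 ≤ v x) :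
    markovLaw κ x₀ {ω | ∃ n, ω n ∈ S} ≤ v x₀ := by
  have hmono : ∀ᵐ ω ∂markovLaw κ x₀, ∀ n, ∀ k ≤ n, ω k ∈ S → ω n ∈ S := by
    filter_upwards [ae_markovLaw_forall_mem_succ x₀ hS hinv] with ω hω n k hkn hk
    exact Nat.le_induction hk (fun m _ => hω m) n hkn
  have hle (n : ℕ) : markovLaw κ x₀ {ω | ω n ∈ S} ≤ v x₀ :=
    calc markovLaw κ x₀ {ω | ω n ∈ S}
      _ = ∫⁻ ω, {ω | ω n ∈ S}.indicator 1 ω ∂markovLaw κ x₀ :=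
          (lintegral_indicator_one (measurable_pi_apply n hS)).symm
      _ ≤ ∫⁻ ω, v (ω n) ∂markovLaw κ x₀ :=
          lintegral_mono (indicator_le fun ω hω => h1 (ω n) hω)
      _ ≤ v x₀ := by
          simpa using lintegral_add_sum_markovLaw_le x₀ hv.measurable measurable_zero
            (by simpa using hv.lintegral_le) n
  rw [ofPred_exists, measure_iUnion_eq_iSup_accumulate]
  refine iSup_le fun n => (measure_mono_ae ?_).trans (hle n)
  filter_upwards [hmono] with ω hω hacc
  obtain ⟨k, hk, hkS⟩ := mem_accumulate.1 hacc
  exact hω n k hk hkS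

end MarkovChain

section Gaussian

variable {H : Type*} [NormedAddCommGroup H] {l ε : ℝ} {x y z : H}

/-- The Gaussian bump centred at `z`, normalised to have height `1`. -/
def gaussian (l : ℝ) (z y : H) : ℝ := Real.exp (-(l * ‖y - z‖ ^ 2))

@[fun_prop]
theorem continuous_gaussian (l : ℝ) (z : H) : Continuous (gaussian l z) := by
  unfold gaussian; fun_prop

theorem gaussian_pos (l : ℝ) (z y : H) : 0 < gaussian l z y := Real.exp_pos _

theorem gaussian_le_one (hl : 0 ≤ l) (z y : H) : gaussian l z y ≤ 1 :=
  Real.exp_le_one_iff.2 (neg_nonpos.2 (by positivity))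

theorem integrable_gaussian [MeasurableSpace H] [BorelSpace H] {μ : Measure H}
    [IsFiniteMeasure μ] (hl : 0 ≤ l) (z : H) : Integrable (gaussian l z) μ :=
  Integrable.of_mem_Icc 0 1 (continuous_gaussian l z).measurable.aemeasurable
    (Filter.Eventually.of_forall fun y => ⟨(gaussian_pos l z y).le, gaussian_le_one hl z y⟩)

theorem one_add_sq_div_two_le_cosh (t : ℝ) : 1 + t ^ 2 / 2 ≤ Real.cosh t := by
  have hcosh : Real.cosh t = 1 + 2 * Real.sinh (t / 2) ^ 2 := by
    linarith [congrArg Real.cosh (mul_div_cancel₀ t (two_ne_zero' ℝ)), Real.cosh_two_mul (t / 2),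
      Real.cosh_sq (t / 2)]
  have hsinh : (t / 2) ^ 2 ≤ Real.sinh (t / 2) ^ 2 := by
    rw [sq_le_sq, Real.abs_sinh]
    exact Real.self_le_sinh_iff.2 (abs_nonneg _)
  linarith

variable [InnerProductSpace ℝ H]

theorem gaussian_add_gaussian_pointReflection (l : ℝ) (x y z : H) :
    (gaussian l z y + gaussian l z (Equiv.pointReflection x y)) / 2 =
      gaussian l z x * (Real.exp (-(l * ‖y - x‖ ^ 2)) *
        Real.cosh (2 * l * inner ℝ (x - z) (y - x))) := by
  have hy : y - z = (x - z) + (y - x) := by abel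
  have hy' : Equiv.pointReflection x y - z = (x - z) - (y - x) := by
    simp only [Equiv.pointReflection_apply, vsub_eq_sub, vadd_eq_add]; abel
  have hexp (s : ℝ) : Real.exp (-(l * (‖x - z‖ ^ 2 + 2 * s + ‖y - x‖ ^ 2))) =
      Real.exp (-(l * ‖x - z‖ ^ 2)) *
        (Real.exp (-(l * ‖y - x‖ ^ 2)) * Real.exp (-(2 * l * s))) := by
    rw [← Real.exp_add, ← Real.exp_add]; ring_nf
  rw [gaussian, gaussian, hy, hy', norm_add_sq_real, norm_sub_sq_real (x - z) (y - x),
    sub_eq_add_neg (‖x - z‖ ^ 2), ← mul_neg 2, hexp, hexp, mul_neg, neg_neg, gaussian, Real.cosh_eq]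
  ring

theorem gaussian_mul_le_gaussian_add_gaussian_pointReflection (hl : 0 ≤ l) (hy : dist y x ≤ ε) :
    gaussian l z x * ((1 - l * ε ^ 2) * (1 + 2 * l ^ 2 * inner ℝ (x - z) (y - x) ^ 2)) ≤
      (gaussian l z y + gaussian l z (Equiv.pointReflection x y)) / 2 := by
  have hexp : 1 - l * ε ^ 2 ≤ Real.exp (-(l * ‖y - x‖ ^ 2)) :=
    calc 1 - l * ε ^ 2 ≤ 1 - l * ‖y - x‖ ^ 2 := by rw [← dist_eq_norm]; gcongr
      _ ≤ Real.exp (-(l * ‖y - x‖ ^ 2)) := Real.one_sub_le_exp_neg _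
  have hcosh : 1 + 2 * l ^ 2 * inner ℝ (x - z) (y - x) ^ 2 ≤
      Real.cosh (2 * l * inner ℝ (x - z) (y - x)) := by
    linear_combination one_add_sq_div_two_le_cosh (2 * l * inner ℝ (x - z) (y - x))
  rw [gaussian_add_gaussian_pointReflection]
  have := (gaussian_pos l z x).le
  gcongr

variable [MeasurableSpace H] [BorelSpace H] {μ : Measure H}

theorem integrable_inner_sq [IsFiniteMeasure μ] (h : ∀ᵐ y ∂μ, dist y x ≤ ε) (u : H) :
    Integrable (fun y => inner ℝ u (y - x) ^ 2) μ := by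
  refine Integrable.of_mem_Icc 0 ((‖u‖ * ε) ^ 2)
    (by fun_prop : Continuous fun y => inner ℝ u (y - x) ^ 2).measurable.aemeasurable ?_
  filter_upwards [h] with y hy
  refine ⟨sq_nonneg _, sq_le_sq.2 ?_⟩
  refine (abs_real_inner_le_norm _ _).trans (le_trans ?_ (le_abs_self _))
  rw [← dist_eq_norm]
  gcongr

/-- Along a symmetric step, a Gaussian bump increases on average at the points far enough from its
centre, where its convexity in the radial direction dominates. -/
theorem gaussian_mul_le_integral [IsProbabilityMeasure μ]
    (hsymm : MeasurePreserving (Equiv.pointReflection x) μ μ) (hdist : ∀ᵐ y ∂μ, dist y x ≤ ε)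
    {v : ℝ} (hvar : v * ε ^ 2 ≤ ∫ y, inner ℝ (x - z) (y - x) ^ 2 ∂μ) (hl : 0 ≤ l)
    (hlε : l * ε ^ 2 ≤ 1 / 2) (hlv : 2 ≤ l * v) :
    gaussian l z x * (1 + l * ε ^ 2) ≤ ∫ y, gaussian l z y ∂μ := by
  have hg := integrable_gaussian (μ := μ) hl z
  have hg' : Integrable (fun y => gaussian l z (Equiv.pointReflection x y)) μ :=
    hsymm.integrable_comp_of_integrable hg
  have hrefl : ∫ y, gaussian l z (Equiv.pointReflection x y) ∂μ = ∫ y, gaussian l z y ∂μ :=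
    hsymm.integral_comp (Homeomorph.pointReflection x).measurableEmbedding _
  have hinner := integrable_inner_sq hdist (x - z)
  set I := ∫ y, inner ℝ (x - z) (y - x) ^ 2 ∂μ
  have hI : 4 * (l * ε ^ 2) ≤ 2 * l ^ 2 * I :=
    calc 4 * (l * ε ^ 2) = 2 * (l * ε ^ 2) * 2 := by ring
      _ ≤ 2 * (l * ε ^ 2) * (l * v) := by gcongr
      _ = 2 * l ^ 2 * (v * ε ^ 2) := by ring
      _ ≤ 2 * l ^ 2 * I := by gcongr
  calc gaussian l z x * (1 + l * ε ^ 2)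
    _ ≤ gaussian l z x * ((1 - l * ε ^ 2) * (1 + 2 * l ^ 2 * I)) := by
        have : 0 ≤ l * ε ^ 2 := by positivity
        gcongr
        · exact (gaussian_pos l z x).le
        · nlinarith
    _ = ∫ y, gaussian l z x *
          ((1 - l * ε ^ 2) * (1 + 2 * l ^ 2 * inner ℝ (x - z) (y - x) ^ 2)) ∂μ := by
        rw [integral_const_mul, integral_const_mul, integral_add (integrable_const 1)
          (hinner.const_mul _), integral_const_mul, integral_const, probReal_univ, one_smul]
    _ ≤ ∫ y, (gaussian l z y + gaussian l z (Equiv.pointReflection x y)) / 2 ∂μ := by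
        refine integral_mono_ae ?_ ((hg.add hg').div_const 2) ?_
        · exact (((integrable_const 1).add (hinner.const_mul _)).const_mul _).const_mul _
        · filter_upwards [hdist] with y hy
            using gaussian_mul_le_gaussian_add_gaussian_pointReflection hl hy
    _ = ∫ y, gaussian l z y ∂μ := by
        rw [integral_div, integral_add hg hg', hrefl, add_self_div_two]

end Gaussian

section AbsorbedWalk

variable {H : Type*} [NormedAddCommGroup H] [InnerProductSpace ℝ H] [MeasurableSpace H]

/-- `κ` is the transition kernel of a random walk which makes symmetric steps of length at most `ε`
and variance at least `c * ε ^ 2` in every direction while it is in `A`, and which is absorbed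
outside `A`. -/
structure IsAbsorbedWalk (κ : Kernel H H) (A : Set H) (ε c : ℝ) : Prop where
  stepLength_pos : 0 < ε
  spread_pos : 0 < c
  measurePreserving_pointReflection :
    ∀ x ∈ A, MeasurePreserving (Equiv.pointReflection x) (κ x) (κ x)
  ae_dist_le_of_mem : ∀ x ∈ A, ∀ᵐ y ∂κ x, dist y x ≤ ε
  le_integral_inner_sq : ∀ x ∈ A, ∀ u, c * ‖u‖ ^ 2 * ε ^ 2 ≤ ∫ y, inner ℝ u (y - x) ^ 2 ∂κ x
  eq_dirac : ∀ x ∉ A, κ x = Measure.dirac x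

theorem exists_forall_le_norm_sub {V : Type*} [NormedAddCommGroup V] [NormedSpace ℝ V]
    [Nontrivial V] {A : Set V} (hA : Bornology.IsBounded A) (s : ℝ) :
    ∃ z, ∀ x ∈ A, s ≤ ‖x - z‖ := by
  obtain ⟨R, hR⟩ := hA.exists_norm_le
  obtain ⟨z, hz⟩ := NormedSpace.exists_lt_norm ℝ V (R + s)
  refine ⟨z, fun x hx => ?_⟩
  linarith [hR x hx, norm_sub_norm_le z x, norm_sub_rev z x]

namespace IsAbsorbedWalk

variable [BorelSpace H] {κ : Kernel H H} {A : Set H} {ε c : ℝ} {x₀ : H}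

theorem ae_dist_le (h : IsAbsorbedWalk κ A ε c) (x : H) : ∀ᵐ y ∂κ x, dist y x ≤ ε := by
  by_cases hx : x ∈ A
  · exact h.ae_dist_le_of_mem x hx
  · rw [h.eq_dirac x hx, ae_dirac_iff (isClosed_closedBall (x := x)).measurableSet, dist_self]
    exact h.stepLength_pos.le

theorem lintegral_one_sub_gaussian_le [IsMarkovKernel κ] (h : IsAbsorbedWalk κ A ε c) {x z : H}
    (hx : x ∈ A) {l : ℝ} (hl : 0 ≤ l) (hlε : l * ε ^ 2 ≤ 1 / 2)
    (hlz : 2 ≤ l * (c * ‖x - z‖ ^ 2)) :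
    ∫⁻ y, ENNReal.ofReal (1 - gaussian l z y) ∂κ x + ENNReal.ofReal (l * ε ^ 2 * gaussian l z x) ≤
      ENNReal.ofReal (1 - gaussian l z x) := by
  have hg := integrable_gaussian (μ := κ x) hl z
  have hmean := gaussian_mul_le_integral (h.measurePreserving_pointReflection x hx)
    (h.ae_dist_le x) (h.le_integral_inner_sq x hx (x - z)) hl hlε hlz
  have hle : ∫ y, gaussian l z y ∂κ x ≤ 1 := by
    simpa using integral_mono hg (integrable_const 1) (gaussian_le_one hl z)
  calc _ = ENNReal.ofReal (1 - ∫ y, gaussian l z y ∂κ x) +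
        ENNReal.ofReal (l * ε ^ 2 * gaussian l z x) := by
        have hint : Integrable (fun y => 1 - gaussian l z y) (κ x) := (integrable_const 1).sub hg
        rw [← ofReal_integral_eq_lintegral_ofReal hint
            (Filter.Eventually.of_forall fun y => sub_nonneg.2 (gaussian_le_one hl z y)),
          integral_sub (integrable_const 1) hg, integral_const, probReal_univ, one_smul]
    _ = ENNReal.ofReal (1 - ∫ y, gaussian l z y ∂κ x + l * ε ^ 2 * gaussian l z x) :=
        (ENNReal.ofReal_add (sub_nonneg.2 hle) (by have := gaussian_pos l z x; positivity)).symm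
    _ ≤ ENNReal.ofReal (1 - gaussian l z x) := ENNReal.ofReal_le_ofReal (by linarith)

theorem isExcessive_one_sub_gaussian [IsMarkovKernel κ] (h : IsAbsorbedWalk κ A ε c) {l : ℝ} {z : H}
    (hl : 0 ≤ l) (hlε : l * ε ^ 2 ≤ 1 / 2) (hlz : ∀ x ∈ A, 2 ≤ l * (c * ‖x - z‖ ^ 2)) :
    IsExcessive κ fun y => ENNReal.ofReal (1 - gaussian l z y) where
  measurable := by fun_prop
  lintegral_le x := by
    by_cases hx : x ∈ A
    · exact le_self_add.trans (h.lintegral_one_sub_gaussian_le hx hl hlε (hlz x hx))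
    · rw [h.eq_dirac x hx, lintegral_dirac' x (by fun_prop)]

theorem ae_markovLaw_eventually_notMem [Nontrivial H] [IsMarkovKernel κ]
    (h : IsAbsorbedWalk κ A ε c) (hA : Bornology.IsBounded A) (hAm : MeasurableSet A) (x₀ : H) :
    ∀ᵐ ω ∂markovLaw κ x₀, ∀ᶠ n in Filter.atTop, ω n ∉ A := by
  have hε := h.stepLength_pos
  have hc := h.spread_pos
  obtain ⟨z, hfar⟩ := exists_forall_le_norm_sub hA (√(4 * ε ^ 2 / c))
  obtain ⟨R, hR⟩ := hA.exists_norm_le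
  set l : ℝ := 1 / (2 * ε ^ 2) with hl
  have hlε : l * ε ^ 2 = 1 / 2 := by rw [hl]; field_simp
  have hlz (x : H) (hx : x ∈ A) : 2 ≤ l * (c * ‖x - z‖ ^ 2) :=
    calc 2 = l * (c * (4 * ε ^ 2 / c)) := by rw [hl]; field_simp; norm_num
      _ ≤ l * (c * ‖x - z‖ ^ 2) := by
        gcongr
        exact (Real.sqrt_le_left (norm_nonneg _)).1 (hfar x hx)
  have hgain (x : H) (hx : x ∈ A) :
      Real.exp (-(l * (R + ‖z‖) ^ 2)) / 2 ≤ l * ε ^ 2 * gaussian l z x := by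
    have hnear : ‖x - z‖ ≤ R + ‖z‖ := (norm_sub_le x z).trans (by gcongr; exact hR x hx)
    rw [hlε, one_div_mul_eq_div 2 (gaussian l z x), gaussian]
    gcongr
  refine DominativeGame.ae_markovLaw_eventually_notMem x₀
    (V := fun y => ENNReal.ofReal (1 - gaussian l z y)) (by fun_prop) hAm
    (c := ENNReal.ofReal (Real.exp (-(l * (R + ‖z‖) ^ 2)) / 2)) (by positivity) (fun x => ?_)
    ENNReal.ofReal_ne_top
  by_cases hx : x ∈ A
  · rw [indicator_of_mem hx]
    refine le_trans ?_ (h.lintegral_one_sub_gaussian_le hx (by positivity) hlε.le (hlz x hx))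
    exact add_le_add_right (ENNReal.ofReal_le_ofReal (hgain x hx)) _
  · rw [indicator_of_notMem hx, add_zero, h.eq_dirac x hx, lintegral_dirac' x (by fun_prop)]

theorem ae_markovLaw_forall_mem_cthickening [IsMarkovKernel κ] (h : IsAbsorbedWalk κ A ε c)
    (hx₀ : x₀ ∈ A) : ∀ᵐ ω ∂markovLaw κ x₀, ∀ n, ω n ∈ cthickening ε A := by
  refine ae_markovLaw_forall_mem x₀ isClosed_cthickening.measurableSet (fun x hx => ?_)
    (self_subset_cthickening A hx₀)
  by_cases hxA : x ∈ A
  · filter_upwards [h.ae_dist_le x] with y hy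
    exact mem_cthickening_of_dist_le y x ε A hxA hy
  · rw [h.eq_dirac x hxA]
    exact (ae_dirac_iff isClosed_cthickening.measurableSet).2 hx

end IsAbsorbedWalk

end AbsorbedWalk

section Barrier

/-- A barrier at `y₀`, relative to the scales `r ≤ δ`: by optional stopping, the chain `κ` started
within distance `r` of `y₀` is absorbed at a distance at least `δ` with probability at most `m`. -/
structure IsBarrier {X : Type*} [PseudoMetricSpace X] [MeasurableSpace X] (κ : Kernel X X) (y₀ : X)
    (δ r : ℝ) (m : ℝ≥0∞) (v : X → ℝ≥0∞) : Prop extends IsExcessive κ v where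
  one_le : ∀ x, δ ≤ dist x y₀ → 1 ≤ v x
  le : ∀ x, dist x y₀ ≤ r → v x ≤ m

open Classical in
theorem IsBarrier.piecewise_inf {X : Type*} [PseudoMetricSpace X] [MeasurableSpace X]
    [OpensMeasurableSpace X] {κ : Kernel X X} {y₀ : X} {δ R s r ε : ℝ} {m θ : ℝ≥0∞}
    {v w : X → ℝ≥0∞} (hv : IsBarrier κ y₀ δ R m v) (hw : IsBarrier κ y₀ s r θ w)
    (hstep : ∀ x, ∀ᵐ y ∂κ x, dist y x ≤ ε) (hsR : s + ε ≤ R) (hrR : r < R) (hRδ : R ≤ δ) :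
    IsBarrier κ y₀ δ r (m * θ) ((ball y₀ R).piecewise (v ⊓ fun x => m * w x) v) where
  toIsExcessive := by
    refine hv.toIsExcessive.piecewise_inf (hw.toIsExcessive.const_mul m) measurableSet_ball ?_
    intro x hx hwv
    have hw1 : w x < 1 := by
      by_contra! hw1
      exact hwv.not_ge ((hv.le x (mem_ball.1 hx).le).trans (le_mul_of_one_le_right' hw1))
    have hxs : dist x y₀ < s := lt_of_not_ge fun hs => hw1.not_ge (hw.one_le x hs)
    filter_upwards [hstep x] with y hy
    exact mem_ball.2 (by linarith [dist_triangle y x y₀])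
  one_le x hx := by
    rw [piecewise_eq_of_notMem _ _ _ fun hxR => (mem_ball.1 hxR).not_ge (hRδ.trans hx)]
    exact hv.one_le x hx
  le x hx := by
    rw [piecewise_eq_of_mem _ _ _ (mem_ball.2 (hx.trans_lt hrR))]
    exact inf_le_right.trans (mul_le_mul_right (hw.le x hx) m)

/-- The factor by which the barrier built from a Gaussian bump with exponent `a / r ^ 2` decreases
between the distances `4 * r` and `r`. -/
def barrierRatio (a : ℝ) : ℝ≥0∞ :=
  ENNReal.ofReal (1 - Real.exp (-(a * 2 ^ 2))) / ENNReal.ofReal (1 - Real.exp (-(a * 3 ^ 2)))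

theorem one_sub_exp_neg_pos {t : ℝ} (ht : 0 < t) : 0 < 1 - Real.exp (-t) :=
  sub_pos.2 (Real.exp_lt_one_iff.2 (neg_lt_zero.2 ht))

theorem barrierRatio_lt_one {a : ℝ} (ha : 0 < a) : barrierRatio a < 1 := by
  have h3 : 0 < 1 - Real.exp (-(a * 3 ^ 2)) := one_sub_exp_neg_pos (by positivity)
  refine ENNReal.div_lt_of_lt_mul ?_
  rw [one_mul, ENNReal.ofReal_lt_ofReal_iff h3]
  gcongr
  norm_num

theorem measurableSet_notMem_and_le_dist {X : Type*} [PseudoMetricSpace X] [MeasurableSpace X]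
    [OpensMeasurableSpace X] {A : Set X} (hA : MeasurableSet A) (δ : ℝ) (y₀ : X) :
    MeasurableSet {y | y ∉ A ∧ δ ≤ dist y y₀} :=
  hA.compl.inter (isClosed_le continuous_const (continuous_id.dist continuous_const)).measurableSet

namespace IsAbsorbedWalk

variable {H : Type*} [NormedAddCommGroup H] [InnerProductSpace ℝ H] [MeasurableSpace H]
  [BorelSpace H] {κ : Kernel H H} [IsMarkovKernel κ] {A : Set H} {ε c : ℝ} {y₀ z : H} {r ρ δ : ℝ}

/-- Seen from a corkscrew ball of `Aᶜ` centred at `z`, the exponent is chosen such that the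
Gaussian bump at `z` increases on average throughout `A`. -/
theorem exists_isBarrier (h : IsAbsorbedWalk κ A ε c) (hr : 0 < r) (hρ : 0 < ρ)
    (hε : 4 * ε ^ 2 ≤ c * (ρ * r) ^ 2) (hz : z ∈ closedBall y₀ r) (hzA : ∀ x ∈ A, ρ * r ≤ ‖x - z‖) :
    ∃ w, IsBarrier κ y₀ (4 * r) r (barrierRatio (2 / (c * ρ ^ 2))) w := by
  have hc := h.spread_pos
  set a := 2 / (c * ρ ^ 2) with ha
  have ha_pos : 0 < a := by positivity
  have hsmall : a / r ^ 2 * ε ^ 2 ≤ 1 / 2 := by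
    rw [ha, div_div, div_mul_eq_mul_div, div_le_div_iff₀ (by positivity) two_pos]
    linarith
  have hfar (x : H) (hx : x ∈ A) : 2 ≤ a / r ^ 2 * (c * ‖x - z‖ ^ 2) :=
    calc 2 = a / r ^ 2 * (c * (ρ * r) ^ 2) := by rw [ha]; field_simp
      _ ≤ a / r ^ 2 * (c * ‖x - z‖ ^ 2) := by gcongr; exact hzA x hx
  have hscale (k : ℝ) : a * k ^ 2 = a / r ^ 2 * (k * r) ^ 2 := by field_simp
  refine ⟨fun y => (ENNReal.ofReal (1 - Real.exp (-(a * 3 ^ 2))))⁻¹ *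
      ENNReal.ofReal (1 - gaussian (a / r ^ 2) z y),
    (h.isExcessive_one_sub_gaussian (by positivity) hsmall hfar).const_mul _, ?_, ?_⟩
  · intro x hx
    have hxz : 3 * r ≤ ‖x - z‖ := by
      rw [← dist_eq_norm]
      linarith [dist_triangle x z y₀, mem_closedBall.1 hz]
    have hpos : 0 < 1 - Real.exp (-(a * 3 ^ 2)) := one_sub_exp_neg_pos (by positivity)
    rw [← ENNReal.inv_mul_cancel (ENNReal.ofReal_pos.2 hpos).ne' ENNReal.ofReal_ne_top]
    gcongr
    rw [hscale 3, gaussian]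
    gcongr
  · intro x hx
    have hxz : ‖x - z‖ ≤ 2 * r := by
      rw [← dist_eq_norm]
      linarith [dist_triangle_right x z y₀, mem_closedBall.1 hz]
    rw [barrierRatio, ENNReal.div_eq_inv_mul, hscale 2, gaussian]
    gcongr

theorem exists_isBarrier_div_pow (h : IsAbsorbedWalk κ A ε c) (hδ : 0 < δ) (hρ : 0 < ρ)
    (hcork : ∀ r ∈ Ioc 0 δ, ∃ z ∈ closedBall y₀ r, ∀ x ∈ A, ρ * r ≤ ‖x - z‖) (n : ℕ)
    (hεn : ε ≤ δ / 8 ^ n) (hε : 4 * ε ^ 2 ≤ c * (ρ * (δ / 8 ^ n)) ^ 2) :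
    ∃ v, IsBarrier κ y₀ δ (δ / 8 ^ n) (barrierRatio (2 / (c * ρ ^ 2)) ^ n) v := by
  have hc := h.spread_pos
  induction n with
  | zero =>
    exact ⟨1, ⟨measurable_one, by simp⟩, by simp, by simp⟩
  | succ n ih =>
    set r := δ / 8 ^ (n + 1) with hr
    have hr_pos : 0 < r := by positivity
    have hscale : δ / 8 ^ n = 8 * r := by rw [hr, pow_succ]; field_simp
    have h8r : 8 * r ≤ δ := hscale ▸ div_le_self hδ.le (one_le_pow₀ (by norm_num))
    obtain ⟨v, hv⟩ := ih (by linarith) (hε.trans (by gcongr; linarith))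
    obtain ⟨z, hz, hzA⟩ := hcork r ⟨hr_pos, by linarith⟩
    obtain ⟨w, hw⟩ := h.exists_isBarrier hr_pos hρ hε hz hzA
    rw [hscale] at hv
    exact ⟨_, pow_succ (barrierRatio _) n ▸
      hv.piecewise_inf hw h.ae_dist_le (by linarith) (by linarith) h8r⟩

theorem markovLaw_absorbed_far_le (h : IsAbsorbedWalk κ A ε c) (hA : MeasurableSet A) {m : ℝ≥0∞}
    {v : H → ℝ≥0∞} (hv : IsBarrier κ y₀ δ r m v) {x : H} (hx : x ∈ closedBall y₀ r) :
    markovLaw κ x {ω | ∃ n, ω n ∉ A ∧ δ ≤ dist (ω n) y₀} ≤ m := by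
  have hS := measurableSet_notMem_and_le_dist hA δ y₀
  refine (hv.markovLaw_exists_mem_le x hS (fun y hy => ?_) fun y hy => hv.one_le y hy.2).trans
    (hv.le x hx)
  rw [h.eq_dirac y hy.1]
  exact (ae_dirac_iff hS).2 hy

end IsAbsorbedWalk

end Barrier

section Corkscrew

/-- At every point of `S` and every small scale `r`, there is a ball of radius comparable to `r`
within distance comparable to `r` that misses `Ω`, with uniform constants. -/
def HasExteriorCorkscrewOn {X : Type*} [PseudoMetricSpace X] (Ω S : Set X) : Prop :=
  ∃ r₀ > 0, ∃ ρ > 0, ∀ y ∈ S, ∀ r ∈ Ioc 0 r₀, ∃ z ∈ closedBall y r, Disjoint (ball z (ρ * r)) Ω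

variable {H : Type*} [NormedAddCommGroup H] [InnerProductSpace ℝ H] [MeasurableSpace H]
  [BorelSpace H]

theorem HasExteriorCorkscrewOn.exists_markovLaw_absorbed_far_le {Ω S : Set H}
    (hΩ : HasExteriorCorkscrewOn Ω S) {c : ℝ} (hc : 0 < c) {δ : ℝ} (hδ : 0 < δ) {m : ℝ≥0∞}
    (hm : 0 < m) :
    ∃ ε₀ > 0, ∃ r > 0, ∀ y₀ ∈ S, ∀ ε < ε₀, ∀ (κ : Kernel H H) [IsMarkovKernel κ],
      IsAbsorbedWalk κ (closure Ω) ε c → ∀ x ∈ closedBall y₀ r,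
        markovLaw κ x {ω | ∃ n, ω n ∉ closure Ω ∧ δ ≤ dist (ω n) y₀} ≤ m := by
  obtain ⟨r₀, hr₀, ρ, hρ, hcork⟩ := hΩ
  obtain ⟨n, hn⟩ := ((ENNReal.tendsto_pow_atTop_nhds_zero_iff.2
    (barrierRatio_lt_one (show 0 < 2 / (c * ρ ^ 2) by positivity))).eventually_le_const hm).exists
  set d := min δ r₀
  have hd : 0 < d := lt_min hδ hr₀
  set r := d / 8 ^ n
  have hr : 0 < r := by positivity
  refine ⟨min r (√c * (ρ * r) / 2), by positivity, r, hr, fun y₀ hy₀ ε hε κ _ hκ x hx => ?_⟩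
  have hεsq : 4 * ε ^ 2 ≤ c * (ρ * r) ^ 2 :=
    calc 4 * ε ^ 2 ≤ 4 * (√c * (ρ * r) / 2) ^ 2 := by
          have := hκ.stepLength_pos
          gcongr
          exact (lt_min_iff.1 hε).2.le
      _ = c * (ρ * r) ^ 2 := by rw [div_pow, mul_pow, Real.sq_sqrt hc.le]; ring
  obtain ⟨v, hv⟩ := hκ.exists_isBarrier_div_pow hd hρ (y₀ := y₀) (fun s hs => by
      obtain ⟨z, hz, hdisj⟩ := hcork y₀ hy₀ s ⟨hs.1, hs.2.trans (min_le_right _ _)⟩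
      refine ⟨z, hz, fun x hx => ?_⟩
      rw [← dist_eq_norm]
      exact not_lt.1 fun hlt =>
        disjoint_left.1 (hdisj.closure_right isOpen_ball) (mem_ball.2 hlt) hx) n
    (lt_min_iff.1 hε).1.le hεsq
  calc markovLaw κ x {ω | ∃ n, ω n ∉ closure Ω ∧ δ ≤ dist (ω n) y₀}
      ≤ markovLaw κ x {ω | ∃ n, ω n ∉ closure Ω ∧ d ≤ dist (ω n) y₀} :=
        measure_mono fun ω ⟨k, hk, hδk⟩ => ⟨k, hk, (min_le_left _ _).trans hδk⟩
    _ ≤ m := (hκ.markovLaw_absorbed_far_le isClosed_closure.measurableSet hv hx).trans hn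

end Corkscrew

section LipschitzDomain

theorem HasExteriorCorkscrewOn.mono {X : Type*} [PseudoMetricSpace X] {Ω S T : Set X}
    (h : HasExteriorCorkscrewOn Ω T) (hST : S ⊆ T) : HasExteriorCorkscrewOn Ω S := by
  obtain ⟨r₀, hr₀, ρ, hρ, h⟩ := h
  exact ⟨r₀, hr₀, ρ, hρ, fun y hy => h y (hST hy)⟩

theorem HasExteriorCorkscrewOn.union {X : Type*} [PseudoMetricSpace X] {Ω S T : Set X}
    (hS : HasExteriorCorkscrewOn Ω S) (hT : HasExteriorCorkscrewOn Ω T) :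
    HasExteriorCorkscrewOn Ω (S ∪ T) := by
  obtain ⟨r₁, hr₁, ρ₁, hρ₁, h₁⟩ := hS
  obtain ⟨r₂, hr₂, ρ₂, hρ₂, h₂⟩ := hT
  refine ⟨min r₁ r₂, lt_min hr₁ hr₂, min ρ₁ ρ₂, lt_min hρ₁ hρ₂, ?_⟩
  rintro y (hy | hy) r ⟨hr, hr'⟩
  · obtain ⟨z, hz, hd⟩ := h₁ y hy r ⟨hr, hr'.trans (min_le_left _ _)⟩
    exact ⟨z, hz, hd.mono_left (ball_subset_ball (by gcongr; exact min_le_left _ _))⟩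
  · obtain ⟨z, hz, hd⟩ := h₂ y hy r ⟨hr, hr'.trans (min_le_right _ _)⟩
    exact ⟨z, hz, hd.mono_left (ball_subset_ball (by gcongr; exact min_le_right _ _))⟩

variable {H : Type*} [NormedAddCommGroup H] [InnerProductSpace ℝ H] {Ω : Set H} {e w x y : H}
  {L : ℝ≥0} {φ : H → ℝ} {r s : ℝ}

theorem norm_sub_inner_smul_le (he : ‖e‖ = 1) (x : H) : ‖x - inner ℝ e x • e‖ ≤ ‖x‖ := by
  rw [← sq_le_sq₀ (norm_nonneg _) (norm_nonneg _), norm_sub_sq_real, norm_smul,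
    inner_smul_right, real_inner_comm e x, he, mul_one, Real.norm_eq_abs, sq_abs]
  nlinarith [sq_nonneg (inner ℝ e x)]

/-- Each point `w` below the graph is the vertex of a cone of points below the graph. -/
theorem inner_le_of_mul_norm_sub_le (he : ‖e‖ = 1) (hφ : LipschitzWith L φ)
    (hw : inner ℝ e w ≤ φ (w - inner ℝ e w • e)) (hx : (1 + L) * ‖x - (w - s • e)‖ ≤ s) :
    inner ℝ e x ≤ φ (x - inner ℝ e x • e) := by
  set d := x - (w - s • e) with hd
  have hinner : inner ℝ e x = inner ℝ e w - s + inner ℝ e d := by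
    rw [hd, inner_sub_right, inner_sub_right, inner_smul_right, real_inner_self_eq_norm_sq, he]
    ring
  have hproj : (w - inner ℝ e w • e) - (x - inner ℝ e x • e) = -(d - inner ℝ e d • e) := by
    rw [hinner, hd]
    module
  have hφd : φ (w - inner ℝ e w • e) - φ (x - inner ℝ e x • e) ≤ L * ‖d‖ :=
    calc _ ≤ L * ‖d - inner ℝ e d • e‖ := by
          rw [← norm_neg, ← hproj]
          exact (le_abs_self _).trans (hφ.norm_sub_le _ _)
      _ ≤ L * ‖d‖ := by gcongr; exact norm_sub_inner_smul_le he d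
  have hed : inner ℝ e d ≤ ‖d‖ := by simpa [he] using real_inner_le_norm e d
  linarith

theorem hasExteriorCorkscrewOn_of_graph (hr : 0 < r) (he : ‖e‖ = 1) (hφ : LipschitzWith L φ)
    (hΩ : ∀ x ∈ ball y r, x ∈ Ω ↔ φ (x - inner ℝ e x • e) < inner ℝ e x) :
    HasExteriorCorkscrewOn Ω (ball y (r / 2) \ Ω) := by
  refine ⟨r / 4, by positivity, 1 / (1 + L), by positivity, ?_⟩
  rintro w ⟨hwy, hwΩ⟩ s ⟨hs, hsr⟩
  rw [mem_ball] at hwy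
  have hdist : dist (w - s • e) w = s := by
    rw [dist_eq_norm, sub_sub_cancel_left, norm_neg, norm_smul, he, mul_one,
      Real.norm_of_nonneg hs.le]
  refine ⟨w - s • e, hdist.le, disjoint_left.2 fun x hx hxΩ => ?_⟩
  rw [mem_ball, one_div_mul_eq_div, lt_div_iff₀' (by positivity)] at hx
  have hxs : dist x (w - s • e) ≤ s :=
    (le_mul_of_one_le_left dist_nonneg (le_add_of_nonneg_right L.2)).trans hx.le
  have hw : inner ℝ e w ≤ φ (w - inner ℝ e w • e) :=
    not_lt.1 fun hlt => hwΩ ((hΩ w (mem_ball.2 (by linarith))).2 hlt)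
  refine (inner_le_of_mul_norm_sub_le he hφ hw (dist_eq_norm x _ ▸ hx.le)).not_gt
    ((hΩ x (mem_ball.2 ?_)).1 hxΩ)
  linarith [dist_triangle4 x (w - s • e) w y]

theorem IsBoundedLipschitzDomain.hasExteriorCorkscrewOn {N : ℕ} {Ω : Set (E N)}
    (hΩ : IsBoundedLipschitzDomain Ω) : HasExteriorCorkscrewOn Ω (frontier Ω) := by
  have hcomp : IsCompact (frontier Ω) :=
    isCompact_of_isClosed_isBounded isClosed_frontier
      (hΩ.isBounded.closure.subset frontier_subset_closure)
  refine hcomp.induction_on ⟨1, one_pos, 1, one_pos, by simp⟩ (fun S T hST hT => hT.mono hST)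
    (fun S T hS hT => hS.union hT) fun y hy => ?_
  obtain ⟨r, e, L, φ, hr, he, hφ, hloc⟩ := hΩ.boundary y hy
  refine ⟨ball y (r / 2) \ Ω, ?_, hasExteriorCorkscrewOn_of_graph hr he hφ hloc⟩
  filter_upwards [self_mem_nhdsWithin, mem_nhdsWithin_of_mem_nhds (ball_mem_nhds y (half_pos hr))]
    with w hw hwy
  exact ⟨hwy, (disjoint_frontier_iff_isOpen.2 hΩ.isOpen).notMem_of_mem_left hw⟩

end LipschitzDomain

section UniformStep

variable {H : Type*} [NormedAddCommGroup H] [MeasurableSpace H] [BorelSpace H] {x : H} {t ε : ℝ}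

theorem ae_dist_le_cond_ball (μ : Measure H) : ∀ᵐ y ∂cond μ (ball x ε), dist y x ≤ ε := by
  filter_upwards [ae_cond_mem (μ := μ) measurableSet_ball] with y hy using (mem_ball.1 hy).le

theorem measurePreserving_pointReflection_cond_ball [SecondCountableTopology H] (μ : Measure H)
    [SFinite μ] [μ.IsAddLeftInvariant] [μ.IsNegInvariant] :
    MeasurePreserving (Equiv.pointReflection x) (cond μ (ball x ε)) (cond μ (ball x ε)) := by
  have hrefl : MeasurePreserving (Equiv.pointReflection x) μ μ := by
    convert Measure.measurePreserving_sub_left μ (x + x) using 2 with y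
    rw [Equiv.pointReflection_apply, vsub_eq_sub, vadd_eq_add]
    abel
  have hball : Equiv.pointReflection x ⁻¹' ball x ε = ball x ε := by
    ext y
    rw [mem_preimage, mem_ball, mem_ball, dist_pointReflection_left, dist_comm]
  exact (hball ▸ hrefl.restrict_preimage measurableSet_ball).smul_measure _

theorem measureReal_cond_ball_ball [NormedSpace ℝ H] [FiniteDimensional ℝ H] (μ : Measure H)
    [μ.IsAddHaarMeasure] {z : H} (hε : 0 < ε) (ht : 0 < t) (h : ball z (t * ε) ⊆ ball x ε) :
    (cond μ (ball x ε)).real (ball z (t * ε)) = t ^ Module.finrank ℝ H := by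
  have hpos : μ.real (ball (0 : H) ε) ≠ 0 :=
    (ENNReal.toReal_pos (measure_ball_pos μ 0 hε).ne' measure_ball_lt_top.ne).ne'
  rw [measureReal_def, cond_apply measurableSet_ball, inter_eq_right.2 h,
    Measure.addHaar_ball_mul_of_pos _ _ ht, Measure.addHaar_ball_center _ x, ENNReal.toReal_mul,
    ENNReal.toReal_mul, ENNReal.toReal_inv, ENNReal.toReal_ofReal (by positivity),
    ← measureReal_def]
  field_simp

variable [InnerProductSpace ℝ H]

/-- The ball of radius `ε / 4` centred at distance `ε / 2` from `x` in the direction of `u`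
contributes enough to the integral. -/
theorem le_integral_inner_sq_cond_ball [FiniteDimensional ℝ H] (μ : Measure H)
    [μ.IsAddHaarMeasure] (hε : 0 < ε) (u : H) :
    (1 / 4) ^ Module.finrank ℝ H / 16 * ‖u‖ ^ 2 * ε ^ 2 ≤
      ∫ y, inner ℝ u (y - x) ^ 2 ∂cond μ (ball x ε) := by
  obtain rfl | hu := eq_or_ne u 0
  · simp
  have : 0 < ‖u‖ := norm_pos_iff.2 hu
  set d := (ε / (2 * ‖u‖)) • u
  have hd : ‖d‖ = ε / 2 := by
    rw [norm_smul, Real.norm_of_nonneg (by positivity)]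
    field_simp
  have hud : inner ℝ u d = ‖u‖ * ε / 2 := by
    rw [inner_smul_right, real_inner_self_eq_norm_sq]
    field_simp
  have hball : ball (x + d) (1 / 4 * ε) ⊆ ball x ε := ball_subset_ball' (by
    rw [dist_self_add_left, hd]
    linarith)
  have hlarge : ball (x + d) (1 / 4 * ε) ⊆ {y | (‖u‖ * ε / 4) ^ 2 ≤ inner ℝ u (y - x) ^ 2} := by
    intro y hy
    rw [mem_ball, dist_eq_norm] at hy
    have hsplit : inner ℝ u (y - x) = inner ℝ u (y - (x + d)) + ‖u‖ * ε / 2 := by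
      rw [← hud, ← inner_add_right, sub_add_eq_sub_sub, sub_add_cancel]
    have herr : |inner ℝ u (y - (x + d))| ≤ ‖u‖ * (1 / 4 * ε) :=
      (abs_real_inner_le_norm _ _).trans (by gcongr)
    have hle : ‖u‖ * ε / 4 ≤ inner ℝ u (y - x) := by linarith [(abs_le.1 herr).1]
    exact pow_le_pow_left₀ (by positivity) hle 2
  have : IsProbabilityMeasure (cond μ (ball x ε)) :=
    cond_isProbabilityMeasure_of_finite (measure_ball_pos μ x hε).ne' measure_ball_lt_top.ne
  calc (1 / 4) ^ Module.finrank ℝ H / 16 * ‖u‖ ^ 2 * ε ^ 2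
    _ = (‖u‖ * ε / 4) ^ 2 * (cond μ (ball x ε)).real (ball (x + d) (1 / 4 * ε)) := by
        rw [measureReal_cond_ball_ball μ hε (by norm_num) hball]
        ring
    _ ≤ (‖u‖ * ε / 4) ^ 2 *
          (cond μ (ball x ε)).real {y | (‖u‖ * ε / 4) ^ 2 ≤ inner ℝ u (y - x) ^ 2} := by
        gcongr
        exact measure_ne_top _ _
    _ ≤ ∫ y, inner ℝ u (y - x) ^ 2 ∂cond μ (ball x ε) :=
        mul_meas_ge_le_integral_of_nonneg (Filter.Eventually.of_forall fun y => sq_nonneg _)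
          (integrable_inner_sq (ae_dist_le_cond_ball μ) u) _

end UniformStep

section Game

variable {N : ℕ} {p ε : ℝ} {Ω : Set (E N)}

theorem stepMeasure_of_mem (p ε : ℝ) (σ : Control Ω) {x : E N} (hx : x ∈ closure Ω) :
    stepMeasure p ε σ x = ENNReal.ofReal (qOf N p) • cond volume (ball x ε) +
      ENNReal.ofReal ((1 - qOf N p) / 2) • (Measure.dirac (x + ε • (σ.1 ⟨x, hx⟩ : E N)) +
        Measure.dirac (x - ε • (σ.1 ⟨x, hx⟩ : E N))) :=
  dif_pos hx

theorem stepMeasure_of_notMem (p ε : ℝ) (σ : Control Ω) {x : E N} (hx : x ∉ closure Ω) :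
    stepMeasure p ε σ x = Measure.dirac x :=
  dif_neg hx

theorem ae_dist_le_stepMeasure (hε : 0 < ε) (σ : Control Ω) {x : E N} (hx : x ∈ closure Ω) :
    ∀ᵐ y ∂stepMeasure p ε σ x, dist y x ≤ ε := by
  have hm : MeasurableSet {y : E N | dist y x ≤ ε} := isClosed_closedBall.measurableSet
  rw [stepMeasure_of_mem p ε σ hx, ae_add_measure_iff]
  refine ⟨Measure.ae_smul_measure (ae_dist_le_cond_ball _) _, Measure.ae_smul_measure ?_ _⟩
  rw [ae_add_measure_iff, ae_dirac_iff hm, ae_dirac_iff hm]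
  simp [dist_eq_norm, norm_smul, abs_of_pos hε]

theorem measurePreserving_pointReflection_stepMeasure (p ε : ℝ) (σ : Control Ω) {x : E N}
    (hx : x ∈ closure Ω) :
    MeasurePreserving (Equiv.pointReflection x) (stepMeasure p ε σ x) (stepMeasure p ε σ x) := by
  have hm : Measurable (Equiv.pointReflection x) := (Homeomorph.pointReflection x).measurable
  refine ⟨hm, ?_⟩
  have hadd (d : E N) : Equiv.pointReflection x (x + d) = x - d := by
    rw [Equiv.pointReflection_apply, vsub_eq_sub, vadd_eq_add]; abel
  have hsub (d : E N) : Equiv.pointReflection x (x - d) = x + d := by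
    rw [Equiv.pointReflection_apply, vsub_eq_sub, vadd_eq_add]; abel
  rw [stepMeasure_of_mem p ε σ hx, Measure.map_add _ _ hm, Measure.map_smul, Measure.map_smul,
    Measure.map_add _ _ hm, Measure.map_dirac' hm, Measure.map_dirac' hm, hadd, hsub,
    (measurePreserving_pointReflection_cond_ball _).map_eq, add_comm (Measure.dirac (x - _))]

/-- A lower bound, relative to `ε ^ 2`, for the variance of a step in any direction. Only the
uniformly distributed part of the step contributes to it, hence it does not depend on the
control. -/
def spread (N : ℕ) (p : ℝ) : ℝ := qOf N p * ((1 / 4) ^ N / 16)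

theorem spread_pos (N : ℕ) (hp : 2 ≤ p) : 0 < spread N p := by
  unfold spread qOf
  positivity

theorem spread_mul_le_integral_inner_sq (hp : 2 ≤ p) (hε : 0 < ε) (σ : Control Ω) {x : E N}
    (hx : x ∈ closure Ω) (u : E N) :
    spread N p * ‖u‖ ^ 2 * ε ^ 2 ≤ ∫ y, inner ℝ u (y - x) ^ 2 ∂stepMeasure p ε σ x := by
  have := isProbabilityMeasure_stepMeasure hp hε σ x
  have hq := qOf_nonneg N hp
  have hint := integrable_inner_sq (ae_dist_le_stepMeasure (p := p) hε σ hx) u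
  rw [stepMeasure_of_mem p ε σ hx, integrable_add_measure] at hint
  calc spread N p * ‖u‖ ^ 2 * ε ^ 2
    _ = qOf N p * ((1 / 4) ^ Module.finrank ℝ (E N) / 16 * ‖u‖ ^ 2 * ε ^ 2) := by
        rw [spread, finrank_euclideanSpace_fin]
        ring
    _ ≤ qOf N p * ∫ y, inner ℝ u (y - x) ^ 2 ∂cond volume (ball x ε) := by
        gcongr
        exact le_integral_inner_sq_cond_ball volume hε u
    _ = ∫ y, inner ℝ u (y - x) ^ 2 ∂(ENNReal.ofReal (qOf N p) • cond volume (ball x ε)) := by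
        rw [integral_smul_measure, ENNReal.toReal_ofReal hq, smul_eq_mul]
    _ ≤ ∫ y, inner ℝ u (y - x) ^ 2 ∂stepMeasure p ε σ x := by
        rw [stepMeasure_of_mem p ε σ hx, integral_add_measure hint.1 hint.2]
        exact le_add_of_nonneg_right (integral_nonneg fun y => sq_nonneg _)

theorem isMarkovKernel_stepKernel (hp : 2 ≤ p) (hε : 0 < ε) (σ : Control Ω) :
    IsMarkovKernel (stepKernel p ε σ) :=
  ⟨isProbabilityMeasure_stepMeasure hp hε σ⟩

theorem isAbsorbedWalk_stepKernel (hp : 2 ≤ p) (hε : 0 < ε) (σ : Control Ω) :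
    IsAbsorbedWalk (stepKernel p ε σ) (closure Ω) ε (spread N p) where
  stepLength_pos := hε
  spread_pos := spread_pos N hp
  measurePreserving_pointReflection _ hx := measurePreserving_pointReflection_stepMeasure p ε σ hx
  ae_dist_le_of_mem _ hx := ae_dist_le_stepMeasure hε σ hx
  le_integral_inner_sq _ hx u := spread_mul_le_integral_inner_sq hp hε σ hx u
  eq_dirac _ hx := stepMeasure_of_notMem p ε σ hx

theorem pathLaw_eq_markovLaw (hp : 2 ≤ p) (hε : 0 < ε) (σ : Control Ω)
    [IsMarkovKernel (stepKernel p ε σ)] (x₀ : E N) :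
    pathLaw hp hε σ x₀ = markovLaw (stepKernel p ε σ) x₀ :=
  rfl

theorem ae_pathLaw_exists_mem_outerStrip [Nontrivial (E N)] (hp : 2 ≤ p) (hε : 0 < ε)
    (hΩ : Bornology.IsBounded Ω) (σ : Control Ω) {x₀ : E N} (hx₀ : x₀ ∈ closure Ω) :
    ∀ᵐ ω ∂pathLaw hp hε σ x₀, ∃ n, ω n ∈ outerStrip Ω ε := by
  have := isMarkovKernel_stepKernel hp hε σ
  have hwalk := isAbsorbedWalk_stepKernel hp hε σ
  rw [pathLaw_eq_markovLaw]
  filter_upwards [hwalk.ae_markovLaw_forall_mem_cthickening hx₀,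
    hwalk.ae_markovLaw_eventually_notMem hΩ.closure isClosed_closure.measurableSet x₀]
    with ω hmem hexit
  obtain ⟨n, hn⟩ := hexit.exists
  rw [cthickening_closure] at hmem
  exact ⟨n, hmem n, hn⟩

theorem payoff_of_mem {F : E N → ℝ} {ω : ℕ → E N} (h : ∃ n, ω n ∈ outerStrip Ω ε) :
    payoff Ω ε F ω = F (ω (sInf {n | ω n ∈ outerStrip Ω ε})) := by
  rw [payoff, exitTime, if_pos h, if_neg (ENat.natCast_ne_top _), ENat.toNat_natCast]

theorem payoff_eq_indicator (F : E N → ℝ) (ω : ℕ → E N) :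
    payoff Ω ε F ω = (outerStrip Ω ε).indicator F (ω (sInf {n | ω n ∈ outerStrip Ω ε})) := by
  by_cases h : ∃ n, ω n ∈ outerStrip Ω ε
  · have hmem : ω (sInf {n | ω n ∈ outerStrip Ω ε}) ∈ outerStrip Ω ε := Nat.sInf_mem h
    rw [payoff_of_mem h, indicator_of_mem hmem]
  · rw [payoff, exitTime, if_neg h, if_pos rfl, indicator_of_notMem fun hn => h ⟨_, hn⟩]

theorem measurable_sInf_nat {α : Type*} [MeasurableSpace α] {P : ℕ → α → Prop}
    (hP : ∀ n, MeasurableSet {a | P n a}) : Measurable fun a => sInf {n | P n a} := by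
  refine measurable_of_Iic fun n => ?_
  have hpre : (fun a => sInf {n | P n a}) ⁻¹' Iic n =
      (⋃ k ≤ n, {a | P k a}) ∪ (⋃ k, {a | P k a})ᶜ := by
    ext a
    simp only [mem_preimage, mem_Iic, mem_union, mem_iUnion, mem_compl_iff, mem_ofPred_eq,
      exists_prop]
    by_cases h : ∃ k, P k a
    · exact ⟨fun hn => Or.inl ⟨_, hn, Nat.sInf_mem h⟩, fun hn =>
        (hn.resolve_right (not_not.2 h)).elim fun k hk => (Nat.sInf_le hk.2).trans hk.1⟩
    · have hempty : {k | P k a} = ∅ := eq_empty_of_forall_notMem fun k hk => h ⟨k, hk⟩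
      simp only [hempty, Nat.sInf_empty, Nat.zero_le, h, not_false_eq_true, or_true]
  rw [hpre]
  exact (MeasurableSet.biUnion (to_countable _) fun k _ => hP k).union
    (MeasurableSet.iUnion hP).compl

theorem measurable_apply_nat {X : Type*} [MeasurableSpace X] {τ : (ℕ → X) → ℕ}
    (hτ : Measurable τ) : Measurable fun ω : ℕ → X => ω (τ ω) := by
  have heval : Measurable fun z : (ℕ → X) × ℕ => z.1 z.2 :=
    measurable_from_prod_countable_left fun n => measurable_pi_apply n
  exact heval.comp (measurable_id.prodMk hτ)

theorem measurableSet_outerStrip : MeasurableSet (outerStrip Ω ε) :=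
  isClosed_cthickening.measurableSet.diff isClosed_closure.measurableSet

theorem measurable_payoff {F : E N → ℝ} (hF : ContinuousOn F (outerStrip Ω ε)) :
    Measurable (payoff Ω ε F) := by
  classical
  have hind : Measurable ((outerStrip Ω ε).indicator F) := by
    rw [← piecewise_eq_indicator]
    exact hF.measurable_piecewise continuousOn_const measurableSet_outerStrip
  have hexit : Measurable fun ω : ℕ → E N => sInf {n | ω n ∈ outerStrip Ω ε} :=
    measurable_sInf_nat fun n => measurableSet_outerStrip.preimage (measurable_pi_apply n)
  rw [funext (payoff_eq_indicator F)]
  exact hind.comp (measurable_apply_nat hexit)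

theorem abs_integral_payoff_sub_le [Nontrivial (E N)] (hp : 2 ≤ p) (hε : 0 < ε)
    (hΩ : Bornology.IsBounded Ω) (σ : Control Ω) {x₀ : E N} (hx₀ : x₀ ∈ closure Ω) {F : E N → ℝ}
    (hF : ContinuousOn F (outerStrip Ω ε)) {y₀ : E N} {a α β δ : ℝ} (hα : 0 ≤ α)
    (hnear : ∀ x ∈ outerStrip Ω ε, dist x y₀ < δ → |F x - a| ≤ α)
    (hfar : ∀ x ∈ outerStrip Ω ε, |F x - a| ≤ β) :
    |∫ ω, payoff Ω ε F ω ∂pathLaw hp hε σ x₀ - a| ≤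
      α + β * (pathLaw hp hε σ x₀).real {ω | ∃ n, ω n ∉ closure Ω ∧ δ ≤ dist (ω n) y₀} := by
  have := isMarkovKernel_stepKernel hp hε σ
  have hprob : IsProbabilityMeasure (pathLaw hp hε σ x₀) := by
    rw [pathLaw_eq_markovLaw]
    infer_instance
  set P := pathLaw hp hε σ x₀
  set B := {ω : ℕ → E N | ∃ n, ω n ∉ closure Ω ∧ δ ≤ dist (ω n) y₀}
  have hB : MeasurableSet B := by
    rw [show B = ⋃ n, {ω | ω n ∉ closure Ω ∧ δ ≤ dist (ω n) y₀} from ofPred_exists _]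
    exact MeasurableSet.iUnion fun n => (measurableSet_notMem_and_le_dist
      isClosed_closure.measurableSet δ y₀).preimage (measurable_pi_apply n)
  have hexit : ∀ᵐ ω ∂P, ∃ x ∈ outerStrip Ω ε, payoff Ω ε F ω = F x ∧ (ω ∉ B → dist x y₀ < δ) := by
    filter_upwards [ae_pathLaw_exists_mem_outerStrip hp hε hΩ σ hx₀] with ω hω
    have hmem := Nat.sInf_mem hω
    exact ⟨_, hmem, payoff_of_mem hω, fun hωB => not_le.1 fun hle => hωB ⟨_, hmem.2, hle⟩⟩
  have hint : Integrable (payoff Ω ε F) P := by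
    refine Integrable.of_mem_Icc (a - β) (a + β) (measurable_payoff hF).aemeasurable ?_
    filter_upwards [hexit] with ω ⟨x, hx, hpay, _⟩
    rw [hpay, ← Real.closedBall_eq_Icc]
    exact hfar x hx
  have hpoint : ∀ᵐ ω ∂P, ‖payoff Ω ε F ω - a‖ ≤ α + B.indicator (fun _ => β) ω := by
    filter_upwards [hexit] with ω ⟨x, hx, hpay, hxB⟩
    rw [hpay, Real.norm_eq_abs]
    by_cases hω : ω ∈ B
    · rw [indicator_of_mem hω]
      exact (hfar x hx).trans (le_add_of_nonneg_left hα)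
    · rw [indicator_of_notMem hω, add_zero]
      exact hnear x hx (hxB hω)
  have hBint : Integrable (B.indicator fun _ => β) P := (integrable_const β).indicator hB
  calc |∫ ω, payoff Ω ε F ω ∂P - a|
    _ = ‖∫ ω, (payoff Ω ε F ω - a) ∂P‖ := by
        rw [integral_sub hint (integrable_const a), integral_const, probReal_univ, one_smul,
          Real.norm_eq_abs]
    _ ≤ ∫ ω, (α + B.indicator (fun _ => β) ω) ∂P :=
        norm_integral_le_of_norm_le ((integrable_const α).add hBint) hpoint
    _ = α + β * P.real B := by
        rw [integral_add (integrable_const α) hBint, integral_const, probReal_univ, one_smul,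
          integral_indicator_const β hB, smul_eq_mul, mul_comm β]

theorem nonempty_control [Nontrivial (E N)] (Ω : Set (E N)) : Nonempty (Control Ω) := by
  obtain ⟨e, he⟩ := exists_norm_eq (E N) zero_le_one
  exact ⟨⟨fun _ => ⟨e, mem_sphere_zero_iff_norm.2 he⟩, measurable_const⟩⟩

theorem abs_ciSup_sub_le {ι : Type*} [Nonempty ι] {f : ι → ℝ} {a b : ℝ}
    (h : ∀ i, |f i - a| ≤ b) : |(⨆ i, f i) - a| ≤ b := by
  have hle (i : ι) : f i ≤ a + b := by linarith [(abs_le.1 (h i)).2]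
  have hge (i : ι) : a - b ≤ f i := by linarith [(abs_le.1 (h i)).1]
  have hsup_ge : a - b ≤ ⨆ i, f i :=
    (hge _).trans (le_ciSup ⟨a + b, forall_mem_range.2 hle⟩ (Classical.arbitrary ι))
  exact abs_le.2 ⟨by linarith, by linarith [ciSup_le hle]⟩

theorem abs_stochasticSolution_sub_le [Nontrivial (E N)] (hp : 2 ≤ p) (hε : 0 < ε)
    (hΩ : Bornology.IsBounded Ω) {x₀ : E N} (hx₀ : x₀ ∈ closure Ω) {F : E N → ℝ}
    (hF : ContinuousOn F (outerStrip Ω ε)) {y₀ : E N} {a α β δ m : ℝ} (hα : 0 ≤ α) (hβ : 0 ≤ β)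
    (hnear : ∀ x ∈ outerStrip Ω ε, dist x y₀ < δ → |F x - a| ≤ α)
    (hfar : ∀ x ∈ outerStrip Ω ε, |F x - a| ≤ β)
    (hm : ∀ σ : Control Ω,
      (pathLaw hp hε σ x₀).real {ω | ∃ n, ω n ∉ closure Ω ∧ δ ≤ dist (ω n) y₀} ≤ m) :
    |stochasticSolution hp hε Ω F x₀ - a| ≤ α + β * m := by
  have := nonempty_control Ω
  refine abs_ciSup_sub_le fun σ => ?_
  exact (abs_integral_payoff_sub_le hp hε hΩ σ hx₀ hF hα hnear hfar).trans
    (by gcongr; exact hm σ)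

theorem abs_stochasticSolution_sub_le_of_lipschitzOnWith [Nontrivial (E N)] (hp : 2 ≤ p)
    (hε : 0 < ε) (hΩ : Bornology.IsBounded Ω) {K : ℝ≥0} {G : E N → ℝ}
    (hG : LipschitzOnWith K G (frontier Ω ∪ outerStrip Ω ε)) {y₀ : E N} (hy₀ : y₀ ∈ frontier Ω)
    {x₀ : E N} (hx₀ : x₀ ∈ closure Ω) {δ m : ℝ} (hδ : 0 ≤ δ)
    (hm : ∀ σ : Control Ω,
      (pathLaw hp hε σ x₀).real {ω | ∃ n, ω n ∉ closure Ω ∧ δ ≤ dist (ω n) y₀} ≤ m) :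
    |stochasticSolution hp hε Ω G x₀ - G y₀| ≤ K * δ + K * diam (enlarged Ω ε) * m := by
  have hlip {x : E N} (hx : x ∈ outerStrip Ω ε) : |G x - G y₀| ≤ K * dist x y₀ :=
    hG.dist_le_mul x (Or.inr hx) y₀ (Or.inl hy₀)
  have hy₀' : y₀ ∈ enlarged Ω ε := closure_subset_cthickening ε Ω (frontier_subset_closure hy₀)
  refine abs_stochasticSolution_sub_le hp hε hΩ hx₀ (hG.continuousOn.mono subset_union_right)
    (by positivity) (mul_nonneg K.2 diam_nonneg) (fun x hx hxδ => ?_) (fun x hx => ?_) hm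
  · exact (hlip hx).trans (by gcongr)
  · exact (hlip hx).trans (by gcongr; exact dist_le_diam_of_mem hΩ.cthickening hx.1 hy₀')

theorem nontrivial_of_nonempty_frontier {X : Type*} [TopologicalSpace X] {s : Set X}
    (hs : (frontier s).Nonempty) : Nontrivial X := by
  by_contra h
  have := not_nontrivial_iff_subsingleton.1 h
  exact hs.ne_empty (isClopen_iff_frontier_eq_empty.1 (isClopen_discrete s))

end Game

end DominativeGame

end

open DominativeGame in
theorem lemma2p6_general {N : ℕ} {p : ℝ} (hp : 2 ≤ p) {Ω : Set (E N)}
    (hΩ : Bornology.IsBounded Ω) (hcork : HasExteriorCorkscrewOn Ω (frontier Ω)) (K : ℝ≥0)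
    {η : ℝ} (hη : 0 < η) :
    ∃ ε₀ > 0, ∃ ε₁ > 0, ∀ y₀ ∈ frontier Ω, ∀ (ε : ℝ) (hε : 0 < ε), ε < ε₀ → ∀ G : E N → ℝ,
      LipschitzOnWith K G (frontier Ω ∪ outerStrip Ω ε) → ∀ x ∈ ball y₀ ε₁ ∩ closure Ω,
        |stochasticSolution hp hε Ω G x - G y₀| ≤ η := by
  set D := diam (enlarged Ω 1)
  set δ := η / (2 * (K + 1))
  set m := η / (2 * (K + 1) * (D + 1))
  have hD : 0 ≤ D := diam_nonneg
  have hδ : 0 < δ := by positivity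
  have hm : 0 < m := by positivity
  obtain ⟨ε₀, hε₀, r, hr, habsorbed⟩ := hcork.exists_markovLaw_absorbed_far_le
    (spread_pos N hp) hδ (ENNReal.ofReal_pos.2 hm)
  refine ⟨min 1 ε₀, lt_min one_pos hε₀, r, hr, fun y₀ hy₀ ε hε hεlt G hG x hx => ?_⟩
  have := nontrivial_of_nonempty_frontier ⟨y₀, hy₀⟩
  have hfar (σ : Control Ω) : (pathLaw hp hε σ x).real
      {ω | ∃ n, ω n ∉ closure Ω ∧ δ ≤ dist (ω n) y₀} ≤ m := by
    have := isMarkovKernel_stepKernel hp hε σ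
    exact ENNReal.toReal_le_of_le_ofReal hm.le (habsorbed y₀ hy₀ ε (lt_min_iff.1 hεlt).2 _
      (isAbsorbedWalk_stepKernel hp hε σ) x (ball_subset_closedBall hx.1))
  have hdiam : diam (enlarged Ω ε) ≤ D :=
    diam_mono (cthickening_mono (lt_min_iff.1 hεlt).1.le Ω) hΩ.cthickening
  calc |stochasticSolution hp hε Ω G x - G y₀|
    _ ≤ K * δ + K * diam (enlarged Ω ε) * m :=
        abs_stochasticSolution_sub_le_of_lipschitzOnWith hp hε hΩ hG hy₀ hx.2 hδ.le hfar
    _ ≤ (K + 1) * δ + (K + 1) * (D + 1) * m := by gcongr <;> linarith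
    _ = η := by simp only [δ, m]; field_simp; norm_num

theorem lemma2p6 {N : ℕ} (hN : 2 ≤ N) {p : ℝ} (hp : 2 ≤ p)
    {Ω : Set (DominativeGame.E N)} (hΩ : DominativeGame.IsBoundedLipschitzDomain Ω)
    {K : ℝ≥0} {F : DominativeGame.E N → ℝ} (hF : LipschitzOnWith K F (frontier Ω)) :
    ∀ η : ℝ, 0 < η → ∃ ε₀ : ℝ, 0 < ε₀ ∧ ∃ ε₁ : ℝ, 0 < ε₁ ∧
      ∀ y₀ ∈ frontier Ω, ∀ (ε : ℝ) (hε : 0 < ε), ε < ε₀ →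
        ∀ G : DominativeGame.E N → ℝ, EqOn G F (frontier Ω) →
          LipschitzOnWith K G (frontier Ω ∪ DominativeGame.outerStrip Ω ε) →
            ∀ x ∈ ball y₀ ε₁ ∩ closure Ω,
              |DominativeGame.stochasticSolution hp hε Ω G x - F y₀| ≤ η := by
  intro η hη
  obtain ⟨ε₀, hε₀, ε₁, hε₁, h⟩ :=
    lemma2p6_general hp hΩ.isBounded hΩ.hasExteriorCorkscrewOn K hη
  exact ⟨ε₀, hε₀, ε₁, hε₁, fun y₀ hy₀ ε hε hlt G hGF hG => hGF hy₀ ▸ h y₀ hy₀ ε hε hlt G hG⟩
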